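/- Let $\Gamma$ be a countable (discrete) amenable group, let $X$ be a compact metric space, and let $T:\Gamma\to\mathrm{Homeo}(X)$, $\gamma\mapsto T_\gamma$, be a group homomorphism. Let $\mathrm{Cov}(X)$ be the set of finite open covers of $X$, and write $\mathcal V\succeq\mathcal U$ if every element of $\mathcal V$ is contained in some element of $\mathcal U$. For a finite family $\mathcal V$ of subsets of $X$ put $\mathrm{ord}(\mathcal V,x)=-1+\sum_{V\in\mathcal V}\mathbf 1_V(x)$. Let $\mathrm{Prob}(X,T)$ be the set of $T$-invariant Borel probability measures on $X$, and define, with values in $[-\infty,+\infty]$, $$\dim(X,T)=\sup_{\mathcal U\in\mathrm{Cov}(X)}\ \inf_{\substack{\mathcal V\in\mathrm{Cov}(X)\\ \mathcal V\succeq\mathcal U}}\ \sup_{\mu\in\mathrm{Prob}(X,T)}\int_X\mathrm{ord}(\mathcal V,x)\,d\mu(x).$$ Let $(F_n)_{n}$ be any F\o lner sequence in $\Gamma$, that is, a sequence of nonempty finite subsets of $\Gamma$ with $|F_n\gamma\,\triangle\,F_n|/|F_n|\to0$ for every $\gamma\in\Gamma$ (for countable $\Gamma$, such a sequence exists exactly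 when $\Gamma$ is amenable). Let $\bigvee_{\gamma\in F_n}T_\gamma(\mathcal U)$ be the cover by all sets $\bigcap_{\gamma\in F_n}T_\gamma(U_\gamma)$ with $U_\gamma\in\mathcal U$, and let Gromov's mean dimension be $$\mathrm{mdim}(X,T)=\sup_{\mathcal U\in\mathrm{Cov}(X)}\ \limsup_{n\to\infty}\frac1{|F_n|}\ \inf_{\substack{\mathcal V\in\mathrm{Cov}(X)\\ \mathcal V\succeq\bigvee_{\gamma\in F_n}T_\gamma(\mathcal U)}}\ \sup_{x\in X}\ \mathrm{ord}(\mathcal V,x)$$ (the limit superior is in fact a limit, and does not depend on the choice of the F\o lner sequence, by the Ornstein--Weiss lemma). Then $$\mathrm{mdim}(X,T)\le\dim(X,T).$$ -/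

import Mathlib

open MeasureTheory Filter Topology
open scoped symmDiff Pointwise

noncomputable section

namespace DynDim

/-- The set `Cov(X)` of finite open covers of `X`. -/
def Cov (X : Type*) [TopologicalSpace X] : Set (Finset (Set X)) :=
  {𝒰 | (∀ U ∈ 𝒰, IsOpen U) ∧ ∀ x : X, ∃ U ∈ 𝒰, x ∈ U}

/-- `𝒱` refines `𝒰`: every member of `𝒱` is contained in some member of `𝒰`. -/
def Refines {X : Type*} (𝒱 𝒰 : Set (Set X)) : Prop :=
  ∀ V ∈ 𝒱, ∃ U ∈ 𝒰, V ⊆ U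

/-- The order of a finite family at a point: `ord(𝒱, x) = -1 + ∑_{V ∈ 𝒱} 1_V(x)`. -/
def ordAt {X : Type*} (𝒱 : Finset (Set X)) (x : X) : ℝ :=
  -1 + ∑ V ∈ 𝒱, V.indicator (fun _ => (1 : ℝ)) x

/-- The order `ord(𝒱) = sup_x ord(𝒱, x)` (it is `-∞` if `X` is empty). -/
def ord {X : Type*} (𝒱 : Finset (Set X)) : EReal :=
  ⨆ x : X, (ordAt 𝒱 x : EReal)

/-- The dimension of a cover: the infimum of `ord(𝒱)` over the finite open covers `𝒱`
that refine `𝒰`. -/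
def coverDim {X : Type*} [TopologicalSpace X] (𝒰 : Set (Set X)) : EReal :=
  ⨅ 𝒱 ∈ {𝒱 : Finset (Set X) | 𝒱 ∈ Cov X ∧ Refines (𝒱 : Set (Set X)) 𝒰}, ord 𝒱

/-- The order of a finite family relative to a set `P` of Borel probability measures:
`ord(𝒱, P) = sup_{μ ∈ P} ∫ ord(𝒱, x) dμ(x)` (it is `-∞` if `P` is empty). -/
def ordMeas {X : Type*} [MeasurableSpace X]
    (𝒱 : Finset (Set X)) (P : Set (ProbabilityMeasure X)) : EReal :=
  ⨆ μ ∈ P, ((∫ x, ordAt 𝒱 x ∂(μ : Measure X) : ℝ) : EReal)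

/-- `dim(𝒰, P)`: the infimum of `ord(𝒱, P)` over the finite open covers `𝒱` that refine `𝒰`. -/
def coverDimMeas {X : Type*} [TopologicalSpace X] [MeasurableSpace X]
    (𝒰 : Set (Set X)) (P : Set (ProbabilityMeasure X)) : EReal :=
  ⨅ 𝒱 ∈ {𝒱 : Finset (Set X) | 𝒱 ∈ Cov X ∧ Refines (𝒱 : Set (Set X)) 𝒰}, ordMeas 𝒱 P

/-- The dimension `dim(X, P)` of a topological-measure pair. -/
def pairDim {X : Type*} [TopologicalSpace X] [MeasurableSpace X]
    (P : Set (ProbabilityMeasure X)) : EReal :=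
  ⨆ 𝒰 ∈ Cov X, coverDimMeas (𝒰 : Set (Set X)) P

/-- The set `Prob(X, T)` of `T`-invariant Borel probability measures. -/
def invProb {Γ X : Type*} [Group Γ] [TopologicalSpace X] [MeasurableSpace X]
    (T : Γ →* (X ≃ₜ X)) : Set (ProbabilityMeasure X) :=
  {μ | ∀ γ : Γ, MeasurePreserving (T γ) (μ : Measure X) (μ : Measure X)}

/-- The dimension `dim(X, T) = dim(X, Prob(X, T))` of a dynamical system. -/
def dynDim {Γ X : Type*} [Group Γ] [TopologicalSpace X] [MeasurableSpace X]
    (T : Γ →* (X ≃ₜ X)) : EReal :=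
  pairDim (invProb T)

/-- The joint refinement `⋁_{γ ∈ F} T_γ(𝒰)`: all sets `⋂_{γ ∈ F} T_γ(U_γ)` with `U_γ ∈ 𝒰`. -/
def joinIterates {Γ X : Type*} [Group Γ] [TopologicalSpace X]
    (T : Γ →* (X ≃ₜ X)) (F : Finset Γ) (𝒰 : Set (Set X)) : Set (Set X) :=
  {W | ∃ u : Γ → Set X, (∀ γ ∈ F, u γ ∈ 𝒰) ∧ W = ⋂ γ ∈ F, T γ '' u γ}

/-- A Følner sequence of nonempty finite subsets of `Γ`: `|F_n γ ∆ F_n| / |F_n| → 0` for every `γ`.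
The translates are on the right because mean dimension is written with `T_γ(𝒰)`: the function
`F ↦ dim(⋁_{γ ∈ F} T_γ(𝒰))` is invariant under translation of `F` on the left. Taking inverses
exchanges this with the convention `|γ F_n ∆ F_n| / |F_n| → 0` and covers `T_γ⁻¹(𝒰)`. -/
structure IsFolnerSeq {Γ : Type*} [Group Γ] (F : ℕ → Finset Γ) : Prop where
  nonempty : ∀ n, (F n).Nonempty
  tendsto : ∀ γ : Γ, Tendsto
    (fun n => ((((fun g => g * γ) '' (F n : Set Γ)) ∆ (F n : Set Γ)).ncard : ℝ) / (F n).card)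
    atTop (𝓝 0)

/-- Gromov's mean dimension
`mdim(X, T) = sup_𝒰 lim_n |F_n|⁻¹ dim(⋁_{γ ∈ F_n} T_γ(𝒰))` along a Følner sequence `F`.
The limit is written as a limit superior, which needs no proof that it exists and is equal to
the limit whenever there is one. -/
def mdim {Γ X : Type*} [Group Γ] [TopologicalSpace X]
    (T : Γ →* (X ≃ₜ X)) (F : ℕ → Finset Γ) : EReal :=
  ⨆ 𝒰 ∈ Cov X, limsup
    (fun n => coverDim (joinIterates T (F n) (𝒰 : Set (Set X))) / ((F n).card : EReal)) atTop

end DynDim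

end

/-!
Let `𝒱` be an open cover refining `𝒰`, with `∫ ord(𝒱, ·) dμ < c` for all invariant `μ`. Some
nonnegative functions `f_V` supported in the `V ∈ 𝒱` have no common zero and satisfy
`#{V | 0 < f_V x} - 1 ≤ G x ≤ ord(𝒱, x)` with `G` continuous. Lay the intervals
`[∑_{V' < V} f_V' x, ∑_{V' ≤ V} f_V' x)` side by side on a half-line, for every translate
`f_V ∘ T_γ⁻¹`, `γ ∈ F_n`. The sets of `x` for which one interval per `γ` has a common point form a
cover refining `⋁ T_γ(𝒰)`. A nonempty intersection of intervals is determined by its left endpoint,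
which is one of the breakpoints, and all `γ` share the breakpoint `0`; hence the order of this cover
at `x` is at most `∑_{γ ∈ F_n} G (T_γ⁻¹ x)`. Since limits of empirical measures along a Følner
sequence are invariant and `G` is continuous, this is eventually less than `c |F_n|`, uniformly
in `x`.
-/

namespace DynDim

open Finset hiding Ico
open Set (Ico)

section StackedIntervals

variable {ι M : Type*} [Fintype ι] [LinearOrder ι] [AddCommGroup M] [LinearOrder M]

/-- The sum of `a` over the indices strictly before `i`: the left endpoint of the `i`-th interval
when intervals of lengths `a` are laid side by side from `0`. -/
def prefixSum (a : ι → M) (i : ι) : M := ∑ j with j < i, a j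

/-- The `i`-th interval when half-open intervals of lengths `a` are laid side by side from `0`. -/
def stackedIco (a : ι → M) (i : ι) : Set M := Ico (prefixSum a i) (prefixSum a i + a i)

/-- The left endpoints of the nonempty intervals among the `stackedIco a i`. -/
def breakpoints (a : ι → M) : Finset M := ({i | 0 < a i} : Finset ι).image (prefixSum a)

theorem card_breakpoints_le (a : ι → M) : #(breakpoints a) ≤ #{i | 0 < a i} := card_image_le

variable {a : ι → M}

theorem exists_pos_prefixSum_eq_zero (ha : 0 ≤ a) (hpos : ∃ i, 0 < a i) :
    ∃ i, 0 < a i ∧ prefixSum a i = 0 := by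
  obtain ⟨i, hi, hmin⟩ := WellFounded.has_min wellFounded_lt {i | 0 < a i} hpos
  refine ⟨i, hi, sum_eq_zero fun j hj => ?_⟩
  exact ((ha j).eq_or_lt.resolve_right fun h => hmin j h (by simpa using hj)).symm

theorem zero_mem_breakpoints (ha : 0 ≤ a) (hpos : ∃ i, 0 < a i) : 0 ∈ breakpoints a := by
  obtain ⟨i, hi, hi0⟩ := exists_pos_prefixSum_eq_zero ha hpos
  exact mem_image.2 ⟨i, by simpa using hi, hi0⟩

variable [IsOrderedAddMonoid M]

theorem pos_of_mem_stackedIco {i : ι} {t : M} (ht : t ∈ stackedIco a i) : 0 < a i :=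
  pos_of_lt_add_right (ht.1.trans_lt ht.2)

theorem prefixSum_add_le_prefixSum (ha : 0 ≤ a) {i j : ι} (hij : i < j) :
    prefixSum a i + a i ≤ prefixSum a j := by
  have hsub : insert i ({k | k < i} : Finset ι) ⊆ ({k | k < j} : Finset ι) := by
    intro k hk
    grind
  rw [prefixSum, add_comm, ← sum_insert (by simp)]
  exact sum_le_sum_of_subset_of_nonneg hsub fun k _ _ => ha k

theorem eq_of_mem_stackedIco (ha : 0 ≤ a) {i j : ι} {t : M} (hi : t ∈ stackedIco a i)
    (hj : t ∈ stackedIco a j) : i = j := by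
  by_contra hne
  rcases lt_or_gt_of_ne hne with hij | hji
  · exact (hi.2.trans_le ((prefixSum_add_le_prefixSum ha hij).trans hj.1)).false
  · exact (hj.2.trans_le ((prefixSum_add_le_prefixSum ha hji).trans hi.1)).false

end StackedIntervals

section Overlaps

theorem exists_left_mem_iInter_Ico {J α : Type*} [Finite J] [Nonempty J] [LinearOrder α]
    {l r : J → α} (h : ∀ i j, l i < r j) : ∃ i, l i ∈ ⋂ j, Ico (l j) (r j) := by
  obtain ⟨i, hi⟩ := Finite.exists_max l
  exact ⟨i, Set.mem_iInter.2 fun j => ⟨hi j, h i j⟩⟩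

theorem nonempty_iInter_Ico_iff {J α : Type*} [Finite J] [Nonempty J] [LinearOrder α]
    {l r : J → α} : (⋂ j, Ico (l j) (r j)).Nonempty ↔ ∀ i j, l i < r j := by
  refine ⟨fun ⟨t, ht⟩ i j => ?_, fun h => (exists_left_mem_iInter_Ico h).imp' l fun _ => id⟩
  rw [Set.mem_iInter] at ht
  exact (ht i).1.trans_lt (ht j).2

theorem card_biUnion_le_one_add_sum_sub_one {J α : Type*} [DecidableEq α] (s : Finset J)
    {B : J → Finset α} {z : α} (hz : ∀ j ∈ s, z ∈ B j) :
    #(s.biUnion B) ≤ 1 + ∑ j ∈ s, (#(B j) - 1) := by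
  have hsub : s.biUnion B ⊆ insert z (s.biUnion fun j => (B j).erase z) := by
    intro b
    simp only [mem_biUnion, mem_insert, mem_erase]
    grind
  calc #(s.biUnion B) ≤ #(s.biUnion fun j => (B j).erase z) + 1 :=
        (card_le_card hsub).trans (card_insert_le _ _)
    _ ≤ ∑ j ∈ s, #((B j).erase z) + 1 := by gcongr; exact card_biUnion_le
    _ = 1 + ∑ j ∈ s, (#(B j) - 1) := by
        rw [add_comm, sum_congr rfl fun j hj => card_erase_of_mem (hz j hj)]

variable {J ι M : Type*} [Fintype J] [Nonempty J] [Fintype ι] [LinearOrder ι]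
  [AddCommGroup M] [LinearOrder M] [IsOrderedAddMonoid M]

theorem card_overlaps_le {a : J → ι → M} (ha : ∀ j, 0 ≤ a j) (hpos : ∀ j, ∃ i, 0 < a j i)
    {K : Finset (J → ι)} (hK : ∀ k ∈ K, (⋂ j, stackedIco (a j) (k j)).Nonempty) :
    #K ≤ 1 + ∑ j, (#{i | 0 < a j i} - 1) := by
  have exists_breakpoint : ∀ k ∈ K, ∃ t, t ∈ univ.biUnion (fun j => breakpoints (a j)) ∧
      t ∈ ⋂ j, stackedIco (a j) (k j) := by
    intro k hk
    obtain ⟨j, hj⟩ := exists_left_mem_iInter_Ico (nonempty_iInter_Ico_iff.1 (hK k hk))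
    have hkj : 0 < a j (k j) := pos_of_mem_stackedIco (Set.mem_iInter.1 hj j)
    exact ⟨_, mem_biUnion.2 ⟨j, mem_univ j, mem_image_of_mem _ (by simpa using hkj)⟩, hj⟩
  calc #K ≤ #(univ.biUnion fun j => breakpoints (a j)) := by
        refine card_le_card_of_forall_subsingleton _ exists_breakpoint fun t _ k hk k' hk' => ?_
        exact funext fun j => eq_of_mem_stackedIco (ha j) (Set.mem_iInter.1 hk.2 j)
          (Set.mem_iInter.1 hk'.2 j)
    _ ≤ 1 + ∑ j, (#(breakpoints (a j)) - 1) :=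
        card_biUnion_le_one_add_sum_sub_one _ fun j _ => zero_mem_breakpoints (ha j) (hpos j)
    _ ≤ 1 + ∑ j, (#{i | 0 < a j i} - 1) := by
        gcongr
        exact card_breakpoints_le _

end Overlaps

section OverlapCover

variable {X J ι : Type*} [Fintype ι] [LinearOrder ι]

/-- The set of points `x` at which the intervals with indices `k j`, in the stacks of lengths
`f j · x`, have a common point. -/
def overlapSet (f : J → ι → X → ℝ) (k : J → ι) : Set X :=
  {x | (⋂ j, stackedIco (f j · x) (k j)).Nonempty}

theorem pos_of_mem_overlapSet {f : J → ι → X → ℝ} {k : J → ι} {x : X} (hx : x ∈ overlapSet f k)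
    (j : J) : 0 < f j (k j) x := by
  obtain ⟨t, ht⟩ := hx
  exact pos_of_mem_stackedIco (a := (f j · x)) (Set.mem_iInter.1 ht j)

theorem exists_mem_overlapSet {f : J → ι → X → ℝ} {x : X} (hf : ∀ j i, 0 ≤ f j i x)
    (hpos : ∀ j, ∃ i, 0 < f j i x) : ∃ k, x ∈ overlapSet f k := by
  choose k hk hk0 using fun j => exists_pos_prefixSum_eq_zero (hf j) (hpos j)
  exact ⟨k, 0, Set.mem_iInter.2 fun j => ⟨(hk0 j).le, by simpa [hk0] using hk j⟩⟩

theorem isOpen_overlapSet [TopologicalSpace X] [Finite J] [Nonempty J] {f : J → ι → X → ℝ}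
    (hf : ∀ j i, Continuous (f j i)) (k : J → ι) : IsOpen (overlapSet f k) := by
  have hcont (j : J) (i : ι) : Continuous fun x => prefixSum (f j · x) i :=
    continuous_finsetSum _ fun i _ => hf j i
  simp only [overlapSet, stackedIco, nonempty_iInter_Ico_iff, Set.ofPred_forall]
  exact isOpen_iInter_of_finite fun i => isOpen_iInter_of_finite fun j =>
    isOpen_lt (hcont i (k i)) ((hcont j (k j)).add (hf j (k j)))

open scoped Classical in
theorem ordAt_image_le {κ : Type*} [Fintype κ] (W : κ → Set X) (x : X) :
    ordAt (univ.image W) x ≤ (#{k | x ∈ W k} : ℝ) - 1 := by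
  have hcard : #{V ∈ univ.image W | x ∈ V} ≤ #{k | x ∈ W k} := by
    rw [filter_image]
    exact card_image_le
  have hsum : ∑ V ∈ univ.image W, V.indicator (fun _ => (1 : ℝ)) x =
      #{V ∈ univ.image W | x ∈ V} := by
    simp only [Set.indicator_apply, sum_boole]
  rw [ordAt, hsum, neg_add_eq_sub]
  gcongr

variable [Fintype J]

open scoped Classical in
/-- The family of all overlap sets of the stacks of lengths `f j`; it is a common refinement of the
covers `{x | 0 < f j i x}`, one for each `j`. -/
noncomputable def overlapCover (f : J → ι → X → ℝ) : Finset (Set X) := univ.image (overlapSet f)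

variable [Nonempty J] {f : J → ι → X → ℝ}

theorem overlapCover_mem_cov [TopologicalSpace X] (hf : ∀ j i, Continuous (f j i))
    (hf0 : ∀ j i x, 0 ≤ f j i x) (hpos : ∀ j x, ∃ i, 0 < f j i x) : overlapCover f ∈ Cov X := by
  classical
  refine ⟨forall_mem_image.2 fun k _ => isOpen_overlapSet hf k, fun x => ?_⟩
  obtain ⟨k, hk⟩ := exists_mem_overlapSet (hf0 · · x) (hpos · x)
  exact ⟨_, mem_image_of_mem _ (mem_univ k), hk⟩

theorem ordAt_overlapCover_le {x : X} (hf : ∀ j i, 0 ≤ f j i x) (hpos : ∀ j, ∃ i, 0 < f j i x) :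
    ordAt (overlapCover f) x ≤ ∑ j, ((#{i | 0 < f j i x} : ℝ) - 1) := by
  classical
  have hone (j : J) : 1 ≤ #{i | 0 < f j i x} :=
    card_pos.2 ((hpos j).imp fun i hi => by simpa using hi)
  have hcard : #{k | x ∈ overlapSet f k} ≤ 1 + ∑ j, (#{i | 0 < f j i x} - 1) :=
    card_overlaps_le (a := (f · · x)) hf hpos fun k hk => (mem_filter.1 hk).2
  calc ordAt (overlapCover f) x ≤ (#{k | x ∈ overlapSet f k} : ℝ) - 1 := ordAt_image_le _ x
    _ ≤ (1 + ∑ j, (#{i | 0 < f j i x} - 1) : ℕ) - 1 := by gcongr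
    _ = ∑ j, ((#{i | 0 < f j i x} : ℝ) - 1) := by
        simp [Nat.cast_sub (hone _)]

end OverlapCover

section Covers

variable {X : Type*} [TopologicalSpace X]

theorem coverDim_le_of_forall_ordAt_le {𝒰 : Set (Set X)} {𝒱 : Finset (Set X)} (h𝒱 : 𝒱 ∈ Cov X)
    (href : Refines (𝒱 : Set (Set X)) 𝒰) {c : ℝ} (hc : ∀ x, ordAt 𝒱 x ≤ c) :
    coverDim 𝒰 ≤ c :=
  (iInf₂_le 𝒱 ⟨h𝒱, href⟩).trans (iSup_le fun x => EReal.coe_le_coe (hc x))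

theorem exists_of_coverDimMeas_lt [MeasurableSpace X] {𝒰 : Set (Set X)}
    {P : Set (ProbabilityMeasure X)} {c : ℝ} (h : coverDimMeas 𝒰 P < c) :
    ∃ 𝒱 ∈ Cov X, Refines (𝒱 : Set (Set X)) 𝒰 ∧ ∀ μ ∈ P, ∫ x, ordAt 𝒱 x ∂(μ : Measure X) < c := by
  simp only [coverDimMeas, iInf_lt_iff] at h
  obtain ⟨𝒱, ⟨h𝒱, href⟩, hlt⟩ := h
  refine ⟨𝒱, h𝒱, href, fun μ hμ => EReal.coe_lt_coe_iff.1 (lt_of_le_of_lt ?_ hlt)⟩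
  exact le_iSup₂ (f := fun (μ : ProbabilityMeasure X) (_ : μ ∈ P) =>
    ((∫ x, ordAt 𝒱 x ∂(μ : Measure X) : ℝ) : EReal)) μ hμ

theorem integrable_ordAt [MeasurableSpace X] [OpensMeasurableSpace X] {𝒱 : Finset (Set X)}
    (h𝒱 : ∀ V ∈ 𝒱, IsOpen V) (μ : Measure X) [IsFiniteMeasure μ] : Integrable (ordAt 𝒱) μ :=
  (integrable_const _).add <| integrable_finsetSum _ fun V hV =>
    (integrable_const _).indicator (h𝒱 V hV).measurableSet

/-- For a bump function `b` of the member `V`, take `f V = (b - 1/2)⁺` and let `min (2 b) 1` be the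
summand of `G` at `V`: it equals `1` wherever `f V` is positive. -/
theorem exists_subordinate_of_mem_cov [NormalSpace X] {𝒱 : Finset (Set X)} (h𝒱 : 𝒱 ∈ Cov X) :
    ∃ (f : 𝒱 → C(X, ℝ)) (G : C(X, ℝ)), (∀ V, 0 ≤ f V) ∧ (∀ x, ∃ V, 0 < f V x) ∧
      (∀ V x, 0 < f V x → x ∈ (V : Set X)) ∧
      (∀ x, (#{V | 0 < f V x} : ℝ) - 1 ≤ G x) ∧ ∀ x, G x ≤ ordAt 𝒱 x := by
  have hcover : Set.univ ⊆ ⋃ V : 𝒱, (V : Set X) := fun x _ => by simpa using h𝒱.2 x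
  obtain ⟨b, hb⟩ := BumpCovering.exists_isSubordinate_of_locallyFinite isClosed_univ _
    (fun V : 𝒱 => h𝒱.1 V V.2) (locallyFinite_of_finite _) hcover
  have mem_of_pos {V : 𝒱} {x : X} (hx : 0 < b V x) : x ∈ (V : Set X) :=
    hb V (subset_tsupport _ hx.ne')
  have pos_iff (V : 𝒱) (x : X) : 0 < max (b V x - 1 / 2) 0 ↔ 1 / 2 < b V x := by simp
  refine ⟨fun V => (b V - .const X (1 / 2)) ⊔ 0, -1 + ∑ V, ((2 : ℝ) • b V) ⊓ 1,
    fun V => le_sup_right, fun x => ?_, fun V x hx => mem_of_pos ?_, fun x => ?_, fun x => ?_⟩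
  · refine ⟨b.ind x (Set.mem_univ x), (pos_iff _ _).2 ?_⟩
    rw [b.ind_apply x (Set.mem_univ x)]
    norm_num
  · linarith [(pos_iff V x).1 hx]
  · have hle : (#{V | 1 / 2 < b V x} : ℝ) ≤ ∑ V, min (2 * b V x) 1 := by
      rw [card_filter, Nat.cast_sum]
      refine sum_le_sum fun V _ => ?_
      have := b.nonneg V x
      split_ifs <;> exact le_min (by push_cast; linarith) (by simp)
    simpa [pos_iff, sub_eq_neg_add] using hle
  · have hle : ∑ V, min (2 * b V x) 1 ≤ ∑ V : 𝒱, (V : Set X).indicator (fun _ => (1 : ℝ)) x := by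
      refine sum_le_sum fun V _ => ?_
      by_cases hx : x ∈ (V : Set X)
      · simp [hx]
      · have := (not_lt.1 (mt mem_of_pos hx)).antisymm (b.nonneg V x)
        simp [hx, this]
    rw [sum_coe_sort 𝒱 (fun V => V.indicator (fun _ => (1 : ℝ)) x)] at hle
    simpa [ordAt] using hle

end Covers

section Dynamics

variable {Γ X : Type*} [Group Γ] [TopologicalSpace X] (T : Γ →* (X ≃ₜ X))

theorem coverDim_joinIterates_le {ι : Type*} [Fintype ι] {F : Finset Γ} (hF : F.Nonempty)
    {𝒰 : Set (Set X)} {f : ι → C(X, ℝ)} (hf : ∀ i, 0 ≤ f i) (hpos : ∀ x, ∃ i, 0 < f i x)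
    (hsub : ∀ i, ∃ U ∈ 𝒰, ∀ x, 0 < f i x → x ∈ U) {c : ℝ}
    (hc : ∀ x, ∑ γ ∈ F, ((#{i | 0 < f i (T γ⁻¹ x)} : ℝ) - 1) ≤ c) :
    coverDim (joinIterates T F 𝒰) ≤ c := by
  classical
  let _ : LinearOrder ι := linearOrderOfSTO WellOrderingRel
  have : Nonempty F := hF.to_subtype
  let g (γ : F) (i : ι) (x : X) : ℝ := f i (T γ⁻¹ x)
  have hgcov : overlapCover g ∈ Cov X := overlapCover_mem_cov
    (fun γ i => (f i).continuous.comp (T γ⁻¹).continuous) (fun _ i _ => hf i _) fun _ _ => hpos _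
  refine coverDim_le_of_forall_ordAt_le hgcov (fun W hW => ?_) fun x => ?_
  · obtain ⟨k, -, rfl⟩ := mem_image.1 hW
    choose U hU hfU using hsub
    let u (γ : Γ) : Set X := if hγ : γ ∈ F then U (k ⟨γ, hγ⟩) else ∅
    refine ⟨_, ⟨u, fun γ hγ => by simpa [u, hγ] using hU _, rfl⟩, fun x hx => ?_⟩
    refine Set.mem_iInter₂.2 fun γ hγ => ⟨T γ⁻¹ x, ?_, ?_⟩
    · simpa [u, hγ] using hfU _ _ (pos_of_mem_overlapSet hx ⟨γ, hγ⟩)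
    · rw [map_inv]
      exact (T γ).apply_symm_apply x
  · calc ordAt (overlapCover g) x ≤ ∑ γ : F, ((#{i | 0 < g γ i x} : ℝ) - 1) :=
          ordAt_overlapCover_le (f := g) (fun _ i => hf i _) fun _ => hpos _
      _ = ∑ γ ∈ F, ((#{i | 0 < f i (T γ⁻¹ x)} : ℝ) - 1) :=
          sum_coe_sort F fun γ => (#{i | 0 < f i (T γ⁻¹ x)} : ℝ) - 1
      _ ≤ c := hc x

theorem abs_sum_translate_sub_le (F : Finset Γ) (η : Γ) {φ : Γ → ℝ} {C : ℝ} (hφ : ∀ γ, |φ γ| ≤ C) :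
    |∑ γ ∈ F, φ (γ * η) - ∑ γ ∈ F, φ γ| ≤
      C * (((fun g => g * η) '' (F : Set Γ)) ∆ (F : Set Γ)).ncard := by
  classical
  have htranslate : ∑ γ ∈ F, φ (γ * η) = ∑ γ ∈ F.image (· * η), φ γ :=
    (sum_image (mul_left_injective η).injOn).symm
  have hsymmDiff : (((fun g => g * η) '' (F : Set Γ)) ∆ (F : Set Γ)).ncard =
      #(F.image (· * η) \ F) + #(F \ F.image (· * η)) := by
    rw [← coe_image, ← coe_symmDiff, Set.ncard_coe_finset, symmDiff_def,
      ← card_union_of_disjoint disjoint_sdiff_sdiff]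
    rfl
  have hbound (s : Finset Γ) : |∑ γ ∈ s, φ γ| ≤ C * #s :=
    calc |∑ γ ∈ s, φ γ| ≤ ∑ γ ∈ s, |φ γ| := abs_sum_le_sum_abs _ _
      _ ≤ #s • C := sum_le_card_nsmul _ _ _ fun γ _ => hφ γ
      _ = C * #s := by rw [nsmul_eq_mul, mul_comm]
  rw [htranslate, ← sum_sdiff_sub_sum_sdiff, hsymmDiff, Nat.cast_add, mul_add]
  exact (abs_sub _ _).trans (add_le_add (hbound _) (hbound _))

variable [MeasurableSpace X]

/-- The uniform probability measure on the orbit segment `T γ⁻¹ x`, `γ ∈ F`, counted with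
multiplicity; the inverses match the covers `T_γ(𝒰)` of `joinIterates`. -/
noncomputable def empirical {F : Finset Γ} (hF : F.Nonempty) (x : X) : ProbabilityMeasure X :=
  ⟨(#F : ENNReal)⁻¹ • ∑ γ ∈ F, Measure.dirac (T γ⁻¹ x), ⟨by
    simpa using ENNReal.inv_mul_cancel (by simpa using hF.ne_empty) (ENNReal.natCast_ne_top #F)⟩⟩

theorem integral_empirical [MeasurableSingletonClass X] {F : Finset Γ} (hF : F.Nonempty) (x : X)
    (φ : X → ℝ) : ∫ y, φ y ∂(empirical T hF x : Measure X) = (∑ γ ∈ F, φ (T γ⁻¹ x)) / #F := by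
  have hint : ∀ γ ∈ F, Integrable φ (Measure.dirac (T γ⁻¹ x)) := fun γ _ =>
    integrable_dirac (by simp)
  rw [empirical, ProbabilityMeasure.coe_mk, integral_smul_measure,
    integral_finsetSum_measure hint]
  simp [div_eq_inv_mul]

variable {T} {F : ℕ → Finset Γ}

theorem IsFolnerSeq.tendsto_integral_translate_sub (hF : IsFolnerSeq F)
    [MeasurableSingletonClass X] {β : Type*} {l : Filter β} {n : β → ℕ}
    (hn : Tendsto n l atTop) (x : β → X) (φ : BoundedContinuousFunction X ℝ) (η : Γ) :
    Tendsto (fun b => ∫ y, φ (T η⁻¹ y) ∂(empirical T (hF.nonempty (n b)) (x b) : Measure X) -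
      ∫ y, φ y ∂(empirical T (hF.nonempty (n b)) (x b) : Measure X)) l (𝓝 0) := by
  have hzero := ((hF.tendsto η).comp hn).const_mul ‖φ‖
  rw [mul_zero] at hzero
  refine squeeze_zero_norm (fun b => ?_) hzero
  have htranslate (γ : Γ) : T η⁻¹ (T γ⁻¹ (x b)) = T (γ * η)⁻¹ (x b) := by
    rw [mul_inv_rev, map_mul]
    rfl
  rw [integral_empirical T _ _ (fun y => φ (T η⁻¹ y)), integral_empirical, ← sub_div, norm_div,
    Real.norm_natCast, Real.norm_eq_abs, Function.comp_apply, ← mul_div_assoc]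
  simp only [htranslate]
  gcongr
  exact abs_sum_translate_sub_le (F (n b)) η (φ := fun γ => φ (T γ⁻¹ (x b))) fun γ =>
    φ.norm_coe_le_norm _

variable [T2Space X] [CompactSpace X] [BorelSpace X]

/-- Without metrizability `μ` itself need not be invariant, as its integrals against continuous
functions determine only its regular representative. -/
theorem exists_mem_invProb_integral_eq (μ : ProbabilityMeasure X)
    (hμ : ∀ (γ : Γ) (φ : BoundedContinuousFunction X ℝ),
      ∫ x, φ (T γ x) ∂(μ : Measure X) = ∫ x, φ x ∂(μ : Measure X)) :
    ∃ ν ∈ invProb T, ∀ φ : BoundedContinuousFunction X ℝ,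
      ∫ x, φ x ∂(ν : Measure X) = ∫ x, φ x ∂(μ : Measure X) := by
  obtain ⟨ν, _, _, hν⟩ := (μ : Measure X).exists_regular_eq_of_compactSpace
  have hprob : IsProbabilityMeasure ν := by
    have := hν 1
    simpa [isProbabilityMeasure_iff_real] using this.symm
  refine ⟨⟨ν, hprob⟩, fun γ => ⟨(T γ).measurable, ?_⟩, fun φ => (hν φ).symm⟩
  have : (ν.map (T γ)).Regular := Measure.Regular.map (T γ)
  change ν.map (T γ) = ν
  refine Measure.ext_of_integral_eq_on_compactlySupported fun φ => ?_
  calc ∫ x, φ x ∂ν.map (T γ) = ∫ x, φ (T γ x) ∂ν :=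
        integral_map (T γ).measurable.aemeasurable φ.continuous.aestronglyMeasurable
    _ = ∫ x, φ x ∂ν := by
        have h1 := hν ((φ : BoundedContinuousFunction X ℝ).compContinuous (T γ))
        have h2 := hν (φ : BoundedContinuousFunction X ℝ)
        exact h1.symm.trans ((hμ γ φ).trans h2)

theorem IsFolnerSeq.eventually_forall_sum_lt (hF : IsFolnerSeq F) {G : C(X, ℝ)} {c : ℝ}
    (hG : ∀ μ ∈ invProb T, ∫ x, G x ∂(μ : Measure X) < c) :
    ∀ᶠ n in atTop, ∀ x, ∑ γ ∈ F n, G (T γ⁻¹ x) < c * #(F n) := by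
  by_contra hcon
  simp only [not_eventually, not_forall, not_lt] at hcon
  obtain ⟨n, hn, hle⟩ := exists_seq_forall_of_frequently hcon
  choose x hx using hle
  let m (b : ℕ) : ProbabilityMeasure X := empirical T (hF.nonempty (n b)) (x b)
  let μ : ProbabilityMeasure X := ((hyperfilter ℕ).map m).lim
  have hlim : ∀ φ : BoundedContinuousFunction X ℝ, Tendsto (fun b => ∫ y, φ y ∂(m b : Measure X))
      (hyperfilter ℕ) (𝓝 (∫ y, φ y ∂(μ : Measure X))) :=
    ProbabilityMeasure.tendsto_iff_forall_integral_tendsto.1 (Ultrafilter.le_nhds_lim _)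
  have hμ (γ : Γ) (φ : BoundedContinuousFunction X ℝ) :
      ∫ y, φ (T γ y) ∂(μ : Measure X) = ∫ y, φ y ∂(μ : Measure X) := by
    have hdiff := hF.tendsto_integral_translate_sub (T := T)
      (hn.mono_left Nat.hyperfilter_le_atTop) x φ γ⁻¹
    rw [inv_inv] at hdiff
    exact sub_eq_zero.1 (tendsto_nhds_unique ((hlim (φ.compContinuous (T γ))).sub (hlim φ)) hdiff)
  obtain ⟨ν, hν, hνμ⟩ := exists_mem_invProb_integral_eq μ hμ
  let φ := BoundedContinuousFunction.mkOfCompact G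
  refine (hG ν hν).not_ge ((ge_of_tendsto' (hlim φ) fun b => ?_).trans_eq (hνμ φ).symm)
  rw [integral_empirical, le_div_iff₀ (by exact_mod_cast (hF.nonempty _).card_pos)]
  exact hx b

theorem IsFolnerSeq.eventually_coverDim_joinIterates_le (hF : IsFolnerSeq F) {𝒰 : Set (Set X)}
    {c : ℝ} (hc : coverDimMeas 𝒰 (invProb T) < c) :
    ∀ᶠ n in atTop, coverDim (joinIterates T (F n) 𝒰) ≤ (c * #(F n) : ℝ) := by
  obtain ⟨𝒱, h𝒱, href, hlt⟩ := exists_of_coverDimMeas_lt hc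
  obtain ⟨f, G, hf, hpos, hsub, hfG, hG⟩ := exists_subordinate_of_mem_cov h𝒱
  have hGlt : ∀ μ ∈ invProb T, ∫ x, G x ∂(μ : Measure X) < c := fun μ hμ =>
    (integral_mono ((BoundedContinuousFunction.mkOfCompact G).integrable (μ : Measure X))
      (integrable_ordAt h𝒱.1 (μ : Measure X)) hG).trans_lt (hlt μ hμ)
  filter_upwards [hF.eventually_forall_sum_lt hGlt] with n hn
  refine coverDim_joinIterates_le T (hF.nonempty n) hf hpos (fun V => ?_) fun x =>
    (sum_le_sum fun γ _ => hfG _).trans (hn x).le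
  obtain ⟨U, hU, hVU⟩ := href V V.2
  exact ⟨U, hU, fun x hx => hVU (hsub V x hx)⟩

end Dynamics

end DynDim

theorem theorem9p3_general {Γ X : Type*} [Group Γ] [TopologicalSpace X] [T2Space X]
    [CompactSpace X] [MeasurableSpace X] [BorelSpace X] (T : Γ →* (X ≃ₜ X)) (F : ℕ → Finset Γ)
    (hF : DynDim.IsFolnerSeq F) : DynDim.mdim T F ≤ DynDim.dynDim T := by
  refine iSup₂_mono fun 𝒰 _ => EReal.le_of_forall_lt_iff_le.1 fun c hc => limsup_le_of_le (h := ?_)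
  filter_upwards [hF.eventually_coverDim_joinIterates_le hc] with n hn
  have hpos : (0 : EReal) < (F n).card := by exact_mod_cast (hF.nonempty n).card_pos
  rw [EReal.div_le_iff_le_mul hpos (EReal.natCast_ne_top _), mul_comm]
  exact_mod_cast hn

theorem theorem9p3 {Γ X : Type*} [Group Γ] [Countable Γ]
    [MetricSpace X] [CompactSpace X] [MeasurableSpace X] [BorelSpace X]
    (T : Γ →* (X ≃ₜ X)) (F : ℕ → Finset Γ) (hF : DynDim.IsFolnerSeq F) :
    DynDim.mdim T F ≤ DynDim.dynDim T :=
  theorem9p3_general T F hF
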